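/- Let $V$ be Thompson's group, acting on the left on the Cantor space $\{0,1\}^\omega$: its elements are the permutations $\varphi$ of $\{0,1\}^\omega$ for which there is a bijection $\beta:P\to Q$ between finite maximal prefix codes $P,Q\subseteq\{0,1\}^*$ such that $\varphi(pt)=\beta(p)\,t$ for all $p\in P$, $t\in\{0,1\}^\omega$. For $x,y\in\{0,1\}^*$ write $\varphi(x)=y$ if $\varphi(xt)=yt$ for all $t\in\{0,1\}^\omega$; let $\mathrm{domC}(\varphi)$ (resp. $\mathrm{imC}(\varphi)$) be the set of words in the domain (resp. image) of this partial function on $\{0,1\}^*$ that have no strict prefix in it. Let $\mathrm{maxlen}(\varphi)=\max\{|z|: z\in\mathrm{domC}(\varphi)\cup\mathrm{imC}(\varphi)\}$ and, for a finite set $\Gamma\subseteq V$, $\mathrm{maxlen}(\Gamma)=\max_{\varphi\in\Gamma}\mathrm{maxlen}(\varphi)$. A set $\Gamma\subseteq V$ is a monoid generating set if every element of $V$ is a product of elements of $\Gamma$. For $w=a_n\cdots a_1\in\Gamma^*$ let $w(\cdot)=a_n\circ\cdots\circ a_1\in V$, and let $\mathsf{cowp}_\Gamma(V)=\{w\in\Gamma^*: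 w(\cdot)\neq \mathrm{id}\}$ be the co-word-problem. For a language $L$ let $L^{\rm rev}$ be the set of the reverses of its words and $\mathsf{cyc}(L)=\{yx: xy\in L\}$. For a class $\mathcal C$ of languages let $\mathcal C^{\rm rev}=\{L^{\rm rev}:L\in\mathcal C\}$, $\mathsf{cyc}(\mathcal C)=\{\mathsf{cyc}(L):L\in\mathcal C\}$, and let $\cup_\ell\,\mathcal C$ be the class of unions of at most $\ell$ languages of $\mathcal C$. Let $\mathsf{DCF}$ be the class of deterministic context-free languages (accepted by final state by deterministic push-down automata). Let $\Gamma_H\subseteq V$ be the set of the four Higman generators, given by the tables $$[\,0\mapsto 1,\ 1\mapsto 0\,],\quad [\,00\mapsto 00,\ 01\mapsto 1,\ 1\mapsto 01\,],\quad [\,0\mapsto 10,\ 10\mapsto 0,\ 11\mapsto 11\,],\quad [\,00\mapsto 00,\ 01\mapsto 10,\ 10\mapsto 01,\ 11\mapsto 11\,].$$ (1) $\Gamma_H$ is a finite monoid generating set of $V$, and $$\mathsf{cowp}_{\Gamma_H}(V)=\mathsf{cyc}(L_{00}\cup L_{01}\cup L_{10}\cup L_{11}),\qquad\text{where } L_z=\{w\in\Gamma_H^*: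 w(z0^\omega)\neq z0^\omega\}.$$ Moreover, $\mathsf{cowp}_{\Gamma_H}(V)\in\mathsf{cyc}(\cup_4\,\mathsf{DCF}^{\rm rev})$ and $\mathsf{cowp}_{\Gamma_H}(V)\in\mathsf{cyc}(\cup_4\,\mathsf{DCF})$. (2) For every finite monoid generating set $\Gamma\subseteq V$ of $V$, $\ \mathsf{cowp}_\Gamma(V)\in\mathsf{cyc}(\cup_\ell\,\mathsf{DCF}^{\rm rev})$ with $\ell=2^{\mathrm{maxlen}(\Gamma)}$. -/

import Mathlib

/-! ### Languages: word problems, cyclic closure, reverse, unions -/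

namespace ThompsonCoWP

/-- `A` generates the group `G` as a monoid. -/
def IsMonoidGeneratingSet {G : Type*} [Group G] (A : Set G) : Prop :=
  Submonoid.closure A = ⊤

/-- The element of `G` represented by a word over `A ⊆ G`
(the product of its letters, from left to right). -/
def wordValue {G : Type*} [Group G] {A : Set G} (w : List A) : G :=
  (w.map Subtype.val).prod

/-- The word problem of `G` over `A`: all words over `A` that represent the identity. -/
def wordProblem {G : Type*} [Group G] (A : Set G) : Language A :=
  {w | wordValue w = 1}

/-- The co-word-problem of `G` over `A`: the complement of the word problem. -/
def coWordProblem {G : Type*} [Group G] (A : Set G) : Language A :=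
  (wordProblem A)ᶜ

/-- The cyclic closure of a language. -/
def cyc {A : Type*} (L : Language A) : Language A :=
  {v | ∃ x y : List A, x ++ y ∈ L ∧ v = y ++ x}

/-- The cyclic closure `{cyc(L) : L ∈ 𝒞}` of a class of languages. -/
def cycClass {A : Type*} (C : Set (Language A)) : Set (Language A) :=
  {K | ∃ L ∈ C, K = cyc L}

/-- The class `{L^rev : L ∈ 𝒞}` of the reverses of the languages in a class. -/
def revClass {A : Type*} (C : Set (Language A)) : Set (Language A) :=
  {K | ∃ L ∈ C, K = L.reverse}

/-- The languages that are the union of at most `ℓ` languages of a class. -/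
def unionClass {A : Type*} (l : ℕ) (C : Set (Language A)) : Set (Language A) :=
  {K | ∃ k ≤ l, ∃ F : Fin k → Language A, (∀ i, F i ∈ C) ∧ K = ⨆ i, F i}

/-! ### Push-down automata -/

/-- A transition `(q, s) --a--> (p, s')` of a push-down automaton with state set `Q`,
input alphabet `A`, stack alphabet `S`. The label `none` stands for the empty word, so that
the transition reads no input. The top of the stack is the left end of a word. -/
structure Transition (Q A S : Type*) where
  src : Q
  pop : List S
  label : Option A
  dst : Q
  push : List S

/-- A push-down automaton with input alphabet `A`. -/
structure PDA (A : Type*) where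
  Q : Type
  S : Type
  finiteQ : Finite Q
  finiteS : Finite S
  transitions : Set (Transition Q A S)
  finite_transitions : transitions.Finite
  /-- There is no transition on the empty stack. -/
  pop_ne_nil : ∀ τ ∈ transitions, τ.pop ≠ []
  start : Q
  initStack : List S
  initStack_ne_nil : initStack ≠ []
  accept : Set Q

namespace PDA

variable {A : Type*}

/-- `M.Reaches w q s`: from the start configuration, the automaton can reach, having read
exactly the input `w`, the state `q` with stack content `s`. -/
inductive Reaches (M : PDA A) : List A → M.Q → List M.S → Prop
  | init : Reaches M [] M.start M.initStack
  | step {w : List A} {τ : Transition M.Q A M.S} {t : List M.S} :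
      τ ∈ M.transitions → Reaches M w τ.src (τ.pop ++ t) →
      Reaches M (w ++ τ.label.toList) τ.dst (τ.push ++ t)

/-- The language accepted by a push-down automaton (acceptance by final state). -/
def language (M : PDA A) : Language A :=
  {w | ∃ q ∈ M.accept, ∃ s, M.Reaches w q s}

/-- `τ` is applicable in state `q` with stack content `s`, when the next input letter
is `next` (`none` if no input letter is left). -/
def Applicable (M : PDA A) (τ : Transition M.Q A M.S) (q : M.Q) (s : List M.S)
    (next : Option A) : Prop :=
  τ ∈ M.transitions ∧ τ.src = q ∧ τ.pop <+: s ∧ (τ.label = none ∨ τ.label = next)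

/-- A push-down automaton is deterministic if in every configuration at most one transition
is applicable. -/
def IsDeterministic (M : PDA A) : Prop :=
  ∀ (q : M.Q) (s : List M.S) (next : Option A) (τ₁ τ₂ : Transition M.Q A M.S),
    M.Applicable τ₁ q s next → M.Applicable τ₂ q s next → τ₁ = τ₂

end PDA

/-- The class of deterministic context-free languages over the alphabet `A`. -/
def DCF (A : Type*) : Set (Language A) :=
  {L | ∃ M : PDA A, M.IsDeterministic ∧ L = M.language}

/-! ### Thompson's group `V`, acting on the left on the Cantor space of infinite bitstrings -/

/-- The Cantor space `{0,1}^ω`, where `false` is the bit 0 and `true` is the bit 1. -/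
abbrev Cantor : Type := Stream' Bool

/-- `g` maps the finite word `x` to the finite word `y`:
`g(x t) = y t` for every infinite bitstring `t`. -/
def Maps (g : Equiv.Perm Cantor) (x y : List Bool) : Prop :=
  ∀ t : Cantor, g (x ++ₛ t) = y ++ₛ t

/-- A prefix code: no element is a strict prefix of another one. -/
def IsPrefixCode (P : Set (List Bool)) : Prop :=
  ∀ p ∈ P, ∀ q ∈ P, p <+: q → p = q

/-- A permutation of the Cantor space that is given by a table, i.e., by a bijection between
two finite maximal prefix codes. -/
def IsThompson (g : Equiv.Perm Cantor) : Prop :=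
  ∃ (P Q : Finset (List Bool)) (β : P ≃ Q),
    Maximal IsPrefixCode (P : Set (List Bool)) ∧
    Maximal IsPrefixCode (Q : Set (List Bool)) ∧ ∀ p : P, Maps g p (β p)

theorem append_stream_inj {x y : List Bool} {s t : Cantor} (h : x.length = y.length)
    (e : x ++ₛ s = y ++ₛ t) : x = y ∧ s = t := by
  induction x generalizing y with
  | nil =>
    cases y with
    | nil => exact ⟨rfl, e⟩
    | cons b y => simp at h
  | cons a x ih =>
    cases y with
    | nil => simp at h
    | cons b y =>
      rw [Stream'.cons_append_stream, Stream'.cons_append_stream] at e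
      obtain ⟨rfl, e'⟩ := Stream'.cons_injective2 e
      obtain ⟨rfl, rfl⟩ := ih (by simpa using h) e'
      exact ⟨rfl, rfl⟩

theorem prefix_of_append_stream {x y : List Bool} {s t : Cantor} (h : x.length ≤ y.length)
    (e : x ++ₛ s = y ++ₛ t) : x <+: y := by
  have h1 : y.take x.length ++ y.drop x.length = y := List.take_append_drop _ _
  rw [← h1, Stream'.append_append_stream] at e
  have h2 := (append_stream_inj (by simp [h]) e).1
  rw [h2]
  exact List.take_prefix _ _

theorem exists_prefix {P : Finset (List Bool)}
    (hP : Maximal IsPrefixCode (P : Set (List Bool))) (x : Cantor) :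
    ∃ p ∈ P, ∃ t, x = p ++ₛ t := by
  by_contra! hcon
  have hlen : ∀ p ∈ P, p.length ≤ P.sup List.length := fun p hp => Finset.le_sup hp
  set N := P.sup List.length
  have hx : x.take N ++ₛ x.drop N = x := Stream'.append_take_drop N x
  have key : ∀ p ∈ P, ¬ p <+: x.take N := by
    rintro p hp ⟨r, hr⟩
    apply hcon p hp (r ++ₛ x.drop N)
    rw [← Stream'.append_append_stream, hr, hx]
  have key2 : ∀ p ∈ P, ¬ x.take N <+: p := by
    intro p hp h
    have := h.eq_of_length_le (by simpa using hlen p hp)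
    exact key p hp (this ▸ List.prefix_rfl)
  have hcode : IsPrefixCode (insert (x.take N) (P : Set (List Bool))) := by
    rintro p (rfl | hp) q (rfl | hq) h
    · rfl
    · exact absurd h (key2 q hq)
    · exact absurd h (key p hp)
    · exact hP.1 p hp q hq h
  have hmem := hP.2 hcode (Set.subset_insert _ _) (Set.mem_insert _ _)
  exact key _ hmem List.prefix_rfl

theorem maximal_of_exists_prefix {P : Set (List Bool)} (hP : IsPrefixCode P)
    (h : ∀ x : Cantor, ∃ p ∈ P, ∃ t, x = p ++ₛ t) : Maximal IsPrefixCode P := by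
  refine ⟨hP, fun P' hP' hle y hy => ?_⟩
  obtain ⟨p, hp, t, ht⟩ := h (y ++ₛ Stream'.const false)
  rcases le_total p.length y.length with hl | hl
  · rwa [← hP' p (hle hp) y hy (prefix_of_append_stream hl ht.symm)]
  · rwa [hP' y hy p (hle hp) (prefix_of_append_stream hl ht)]

theorem isThompson_iff (g : Equiv.Perm Cantor) :
    IsThompson g ↔ ∃ N : ℕ, ∀ x : List Bool, x.length = N → ∃ y, Maps g x y := by
  constructor
  · rintro ⟨P, Q, β, hP, -, h⟩
    refine ⟨P.sup List.length, fun x hx => ?_⟩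
    obtain ⟨p, hp, t, ht⟩ := exists_prefix hP (x ++ₛ Stream'.const false)
    have hl : p.length ≤ x.length := hx ▸ Finset.le_sup (f := List.length) hp
    obtain ⟨r, rfl⟩ := prefix_of_append_stream hl ht.symm
    refine ⟨β ⟨p, hp⟩ ++ r, fun s => ?_⟩
    rw [Stream'.append_append_stream, Stream'.append_append_stream]
    exact h ⟨p, hp⟩ _
  · rintro ⟨N, h⟩
    choose! f hf using h
    let P : Finset (List Bool) := (List.finite_length_eq Bool N).toFinset
    have hPm : ∀ {x}, x ∈ P ↔ x.length = N := by simp [P]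
    have hcov : ∀ x : Cantor, ∃ p ∈ P, ∃ t, x = p ++ₛ t := fun x =>
      ⟨x.take N, by simp [hPm], x.drop N, (Stream'.append_take_drop N x).symm⟩
    have hpre : ∀ p ∈ P, ∀ q ∈ P, f p <+: f q → p = q := by
      rintro p hp q hq ⟨r, hr⟩
      have h1 : g (q ++ₛ Stream'.const false) = g (p ++ₛ (r ++ₛ Stream'.const false)) := by
        rw [hf q (hPm.1 hq), hf p (hPm.1 hp), ← hr, Stream'.append_append_stream]
      exact (append_stream_inj ((hPm.1 hq).trans (hPm.1 hp).symm) (g.injective h1)).1.symm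
    let F : P → (P.image f : Finset (List Bool)) := fun p =>
      ⟨f p, Finset.mem_image_of_mem f p.2⟩
    have hF : Function.Bijective F := by
      constructor
      · intro p q hpq
        have : f p = f q := congrArg Subtype.val hpq
        exact Subtype.ext (hpre p p.2 q q.2 (this ▸ List.prefix_rfl))
      · rintro ⟨y, hy⟩
        obtain ⟨p, hp, rfl⟩ := Finset.mem_image.1 hy
        exact ⟨⟨p, hp⟩, rfl⟩
    refine ⟨P, P.image f, Equiv.ofBijective F hF, ?_, ?_, fun p => hf p (hPm.1 p.2)⟩
    · refine maximal_of_exists_prefix (fun p hp q hq hpq => ?_) hcov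
      exact hpq.eq_of_length ((hPm.1 hp).trans (hPm.1 hq).symm)
    · refine maximal_of_exists_prefix ?_ fun x => ?_
      · intro y hy z hz hyz
        obtain ⟨p, hp, rfl⟩ := Finset.mem_image.1 (Finset.mem_coe.1 hy)
        obtain ⟨q, hq, rfl⟩ := Finset.mem_image.1 (Finset.mem_coe.1 hz)
        rw [hpre p hp q hq hyz]
      · obtain ⟨p, hp, t, ht⟩ := hcov (g.symm x)
        refine ⟨f p, Finset.mem_coe.2 (Finset.mem_image_of_mem f hp), t, ?_⟩
        rw [← hf p (hPm.1 hp), ← ht, Equiv.apply_symm_apply]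

/-- Thompson's group `V`, as a group of permutations of the Cantor space. -/
def thompsonV : Subgroup (Equiv.Perm Cantor) where
  carrier := {g | IsThompson g}
  one_mem' := (isThompson_iff 1).2 ⟨0, fun x _ => ⟨x, fun _ => rfl⟩⟩
  mul_mem' := by
    intro g h hg hh
    obtain ⟨N, hN⟩ := (isThompson_iff g).1 hg
    obtain ⟨M, hM⟩ := (isThompson_iff h).1 hh
    refine (isThompson_iff _).2 ⟨M + N, fun x hx => ?_⟩
    obtain ⟨y, hy⟩ := hM (x.take M) (by simp [hx])
    obtain ⟨z, hz⟩ := hN ((y ++ x.drop M).take N) (by simp [hx])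
    refine ⟨z ++ (y ++ x.drop M).drop N, fun t => ?_⟩
    have h1 : h (x ++ₛ t) = (y ++ x.drop M) ++ₛ t := by
      conv_lhs => rw [← List.take_append_drop M x, Stream'.append_append_stream]
      rw [hy, Stream'.append_append_stream]
    rw [Equiv.Perm.mul_apply, h1]
    conv_lhs => rw [← List.take_append_drop N (y ++ x.drop M), Stream'.append_append_stream]
    rw [hz, Stream'.append_append_stream]
  inv_mem' := by
    rintro g ⟨P, Q, β, hP, hQ, h⟩
    refine ⟨Q, P, β.symm, hQ, hP, fun q t => ?_⟩
    rw [Equiv.Perm.inv_eq_iff_eq, h (β.symm q) t, Equiv.apply_symm_apply]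

/-- `Dom(φ) ⊆ {0,1}^*`, where `φ` is viewed as a maximally extended right-ideal morphism. -/
def Dom (φ : thompsonV) : Set (List Bool) := {x | ∃ y, Maps φ x y}

/-- `Im(φ) ⊆ {0,1}^*`, where `φ` is viewed as a maximally extended right-ideal morphism. -/
def Im (φ : thompsonV) : Set (List Bool) := {y | ∃ x, Maps φ x y}

/-- The prefix code that generates a right ideal `R` of `{0,1}^*`:
the elements of `R` that have no strict prefix in `R`. -/
def idealCode (R : Set (List Bool)) : Set (List Bool) :=
  {x | x ∈ R ∧ ∀ y ∈ R, y <+: x → y = x}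

/-- The domain code of `φ`. -/
def domC (φ : thompsonV) : Set (List Bool) := idealCode (Dom φ)

/-- The image code of `φ`. -/
def imC (φ : thompsonV) : Set (List Bool) := idealCode (Im φ)

/-- The maximal length of the words in `domC(φ) ∪ imC(φ)`. -/
noncomputable def maxlen (φ : thompsonV) : ℕ :=
  sSup (List.length '' (domC φ ∪ imC φ))

/-- The maximum of `maxlen` over a finite subset of `V`. -/
noncomputable def maxlenSet (Γ : Set thompsonV) : ℕ :=
  sSup (maxlen '' Γ)

theorem idealCode_length_le {R : Set (List Bool)} {N : ℕ}
    (h : ∀ x : List Bool, x.length = N → x ∈ R) {x : List Bool} (hx : x ∈ idealCode R) :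
    x.length ≤ N := by
  by_contra! hlt
  have h1 : (x.take N).length = N := by simp [hlt.le]
  have h2 := hx.2 _ (h _ h1) (List.take_prefix N x)
  rw [h2] at h1
  omega

/-- The supremum in `maxlen` is a maximum over a non-empty bounded set. -/
theorem maxlen_isGreatest (φ : thompsonV) :
    IsGreatest (List.length '' (domC φ ∪ imC φ)) (maxlen φ) := by
  obtain ⟨N, hN⟩ := (isThompson_iff φ).1 φ.2
  obtain ⟨M, hM⟩ := (isThompson_iff _).1 (φ⁻¹).2
  have hIm : ∀ x : List Bool, x.length = M → x ∈ Im φ := by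
    intro x hx
    obtain ⟨y, hy⟩ := hM x hx
    refine ⟨y, fun t => ?_⟩
    rw [← hy t]
    simp
  have hbdd : BddAbove (List.length '' (domC φ ∪ imC φ)) := by
    refine ⟨max N M, ?_⟩
    rintro _ ⟨x, hx | hx, rfl⟩
    · exact le_max_of_le_left (idealCode_length_le hN hx)
    · exact le_max_of_le_right (idealCode_length_le hIm hx)
  have hne : (List.length '' (domC φ ∪ imC φ)).Nonempty := by
    obtain ⟨x, hx, hmin⟩ := exists_minimal_of_wellFoundedLT
      (fun n : ℕ => ∃ x ∈ Dom φ, x.length = n)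
      ⟨N, List.replicate N false, hN _ (by simp), by simp⟩
    obtain ⟨z, hz, rfl⟩ := hx
    refine ⟨_, z, Or.inl ⟨hz, fun y hy hyz => ?_⟩, rfl⟩
    exact hyz.eq_of_length_le (hmin ⟨y, hy, rfl⟩ hyz.length_le)
  exact ⟨Nat.sSup_mem hne hbdd, fun n hn => le_csSup hbdd hn⟩

/-- `0^ω`. -/
def zeros : Cantor := Stream'.const false

/-- The language `L_z` of all words `w` over `Γ` with `w(z 0^ω) ≠ z 0^ω`. -/
def movingLanguage (Γ : Set thompsonV) (z : List Bool) : Language Γ :=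
  {w | ((wordValue w : thompsonV) : Equiv.Perm Cantor) (z ++ₛ zeros) ≠ z ++ₛ zeros}

/-! ### The Higman generators -/

/-- The four tables of the Higman generators. -/
def higmanTables : List (List (List Bool × List Bool)) :=
  [ [([false], [true]), ([true], [false])],
    [([false, false], [false, false]), ([false, true], [true]), ([true], [false, true])],
    [([false], [true, false]), ([true, false], [false]), ([true, true], [true, true])],
    [([false, false], [false, false]), ([false, true], [true, false]),
      ([true, false], [false, true]), ([true, true], [true, true])] ]

/-- `g` is the element of `V` that is given by the table `T`. -/
def HasTable (g : thompsonV) (T : List (List Bool × List Bool)) : Prop :=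
  ∀ e ∈ T, Maps g e.1 e.2

/-- The set of Higman generators of `V`. -/
def higmanGenerators : Set thompsonV := {g | ∃ T ∈ higmanTables, HasTable g T}

theorem cantor_cases (x : Cantor) : ∃ (a b : Bool) (t : Cantor), x = [a, b] ++ₛ t :=
  ⟨x.get 0, x.get 1, x.drop 2, (Stream'.append_take_drop 2 x).symm⟩

/-- Each of the four Higman tables describes exactly one element of `V`. -/
theorem existsUnique_hasTable : ∀ T ∈ higmanTables, ∃! g : thompsonV, HasTable g T := by
  have build : ∀ (T : List (List Bool × List Bool)) (f : Cantor → Cantor),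
      (∀ e ∈ T, ∀ t, f (e.1 ++ₛ t) = e.2 ++ₛ t) →
      (∀ a b : Bool, ∃ e ∈ T, (e.2, e.1) ∈ T ∧ ∃ r, [a, b] = e.1 ++ r) →
      ∃! g : thompsonV, HasTable g T := by
    intro T f hf hT
    have hinv : Function.Involutive f := by
      intro x
      obtain ⟨a, b, t, rfl⟩ := cantor_cases x
      obtain ⟨e, he, he', r, hr⟩ := hT a b
      rw [hr, Stream'.append_append_stream, hf e he]
      exact hf _ he' _
    refine ⟨⟨hinv.toPerm, (isThompson_iff _).2 ⟨2, fun x hx => ?_⟩⟩, hf, fun g hg => ?_⟩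
    · obtain ⟨a, b, rfl⟩ := List.length_eq_two.1 hx
      obtain ⟨e, he, -, r, hr⟩ := hT a b
      refine ⟨e.2 ++ r, fun t => ?_⟩
      rw [hr, Stream'.append_append_stream, Stream'.append_append_stream]
      exact hf e he _
    · apply Subtype.ext
      ext1 x
      obtain ⟨a, b, t, rfl⟩ := cantor_cases x
      obtain ⟨e, he, -, r, hr⟩ := hT a b
      rw [hr, Stream'.append_append_stream]
      exact (hg e he _).trans (hf e he _).symm
  have hd : ∀ T : List (List Bool × List Bool),
      (∀ a b : Bool, ∃ e ∈ T, (e.2, e.1) ∈ T ∧ e.1 <+: [a, b]) →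
      ∀ a b : Bool, ∃ e ∈ T, (e.2, e.1) ∈ T ∧ ∃ r, [a, b] = e.1 ++ r := by
    intro T h a b
    obtain ⟨e, he, he', r, hr⟩ := h a b
    exact ⟨e, he, he', r, hr.symm⟩
  intro T hT
  simp only [higmanTables, List.mem_cons, List.not_mem_nil, or_false] at hT
  rcases hT with rfl | rfl | rfl | rfl
  · refine build _ (fun x => Stream'.cons (!x.get 0) (x.drop 1)) ?_ (hd _ (by decide))
    simp only [List.forall_mem_cons]
    exact ⟨fun t => rfl, fun t => rfl, by simp⟩
  · refine build _ (fun x => match x.get 0, x.get 1 with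
      | false, false => x
      | false, true => [true] ++ₛ x.drop 2
      | true, _ => [false, true] ++ₛ x.drop 1) ?_ (hd _ (by decide))
    simp only [List.forall_mem_cons]
    exact ⟨fun t => rfl, fun t => rfl, fun t => rfl, by simp⟩
  · refine build _ (fun x => match x.get 0, x.get 1 with
      | false, _ => [true, false] ++ₛ x.drop 1
      | true, false => [false] ++ₛ x.drop 2
      | true, true => x) ?_ (hd _ (by decide))
    simp only [List.forall_mem_cons]
    exact ⟨fun t => rfl, fun t => rfl, fun t => rfl, by simp⟩
  · refine build _ (fun x => [x.get 1, x.get 0] ++ₛ x.drop 2) ?_ (hd _ (by decide))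
    simp only [List.forall_mem_cons]
    exact ⟨fun t => rfl, fun t => rfl, fun t => rfl, fun t => rfl, by simp⟩

end ThompsonCoWP

open ThompsonCoWP

namespace ThompsonCoWP

/-! ### Partial actions on words -/

/-! If some cyclic shift of `w` moves a point, then `w` is not the identity, being conjugate to that
shift. The converse is the heart of the matter (`wordValue_eq_one_of_cyclic_shifts_fix`). Let `m`
bound the lengths of the domain-code words of the letters, and let all cyclic shifts of `w` fix all
points `z 0^ω` with `|z| = m`. Let `w` act letter by letter on finite words, never extending them.
The minimal words `u` that survive this form a maximal prefix code, and `w` acts by a table with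
rows `(u, v)`. By minimality some letter meets a word of its own domain code along the way
(`Run.parent_or_domC`). The cyclic shift that starts with this letter fixes the left end of that
cone, so by conjugation `w` fixes `u 0^ω`. A table that fixes the left ends of all its cones is
trivial (`eq_one_of_fixes_left_ends`).

For the language classes, a push-down automaton keeps on its stack a word `u` without trailing 0
that represents the current point `u 0^ω`. A letter changes only a bounded prefix of it. The letter
acting first is the last one of `w`, whence the reversal (`orbitPDA_language`). The `2 ^ m` words
`z` of length `m` give the union. Higman generators are involutions, so there each `L_z` equals its
own reverse.

That the Higman generators generate `V` is shown in two steps: they generate all exchanges of two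
disjoint cones (`hasSwap`), and these exchanges generate `V`
(`mem_closure_higmanGenerators_of_code`). -/

theorem Maps.comp {g h : Equiv.Perm Cantor} {u v w : List Bool} (hh : Maps h v w)
    (hg : Maps g u v) : Maps (h * g) u w := fun t => by
  rw [Equiv.Perm.mul_apply, hg, hh]

theorem Maps.append {g : Equiv.Perm Cantor} {u v : List Bool} (h : Maps g u v) (r : List Bool) :
    Maps g (u ++ r) (v ++ r) := fun t => by
  rw [Stream'.append_append_stream, Stream'.append_append_stream, h]

theorem Maps.inv {g : Equiv.Perm Cantor} {u v : List Bool} (h : Maps g u v) :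
    Maps g⁻¹ v u := fun t => by
  rw [Equiv.Perm.inv_eq_iff_eq, h]

theorem Maps.one (u : List Bool) : Maps 1 u u := fun _ => rfl

theorem Maps.of_children {g : Equiv.Perm Cantor} {u v : List Bool}
    (h : ∀ b, Maps g (u ++ [b]) (v ++ [b])) : Maps g u v := fun t => by
  have := h (t.head) t.tail
  rwa [Stream'.append_append_stream, Stream'.append_append_stream, Stream'.cons_append_stream,
    Stream'.nil_append_stream, Stream'.cons_head_tail] at this

theorem append_stream_left_injective (u : List Bool) :
    Function.Injective (fun t : Cantor => u ++ₛ t) := fun _ _ e =>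
  (append_stream_inj rfl e).2

theorem prefix_or_prefix_of_append_stream {x y : List Bool} {s t : Cantor}
    (e : x ++ₛ s = y ++ₛ t) : x <+: y ∨ y <+: x :=
  (le_total x.length y.length).imp (fun h => prefix_of_append_stream h e)
    fun h => prefix_of_append_stream h e.symm

theorem Maps.prefix_or_prefix {g : Equiv.Perm Cantor} {u u' v v' : List Bool} (h : Maps g u v)
    (h' : Maps g u' v') (hv : v <+: v') : u <+: u' ∨ u' <+: u := by
  obtain ⟨r, rfl⟩ := hv
  refine prefix_or_prefix_of_append_stream (s := r ++ₛ zeros) (t := zeros) (g.injective ?_)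
  rw [h, h', Stream'.append_append_stream]

/-- If `v` began with a letter `a`, the cone below `v` would already map onto the whole space,
leaving no image for the constant sequence of the other letter. -/
theorem eq_nil_of_maps_nil_right {g : Equiv.Perm Cantor} {v : List Bool} (h : Maps g v []) :
    v = [] := by
  cases v with
  | nil => rfl
  | cons a v =>
    have h1 := h (g (Stream'.const !a))
    rw [Stream'.nil_append_stream] at h1
    have h2 := congrArg Stream'.head (g.injective h1)
    rw [Stream'.cons_append_stream, Stream'.head_cons] at h2
    have h3 : (Stream'.const !a).head = !a := rfl
    rw [h3] at h2
    cases a <;> simp at h2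

theorem eq_one_of_maps_nil {g : Equiv.Perm Cantor} {v : List Bool} (h : Maps g [] v) :
    g = 1 := by
  obtain rfl := eq_nil_of_maps_nil_right h.inv
  exact Equiv.ext h

/-- `g` exchanges the cones below `u` and `v`, and fixes all other points. -/
structure IsSwap (g : Equiv.Perm Cantor) (u v : List Bool) : Prop where
  left : Maps g u v
  right : Maps g v u
  fix : ∀ x, (∀ t, x ≠ u ++ₛ t) → (∀ t, x ≠ v ++ₛ t) → g x = x

theorem IsSwap.symm {g : Equiv.Perm Cantor} {u v : List Bool} (h : IsSwap g u v) :
    IsSwap g v u := ⟨h.right, h.left, fun x h1 h2 => h.fix x h2 h1⟩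

theorem IsSwap.conj {s h : Equiv.Perm Cantor} {u v u' v' : List Bool} (hs : IsSwap s u' v')
    (hu : Maps h u u') (hv : Maps h v v') : IsSwap (h⁻¹ * s * h) u v := by
  refine ⟨(hv.inv.comp hs.left).comp hu, (hu.inv.comp hs.right).comp hv, fun x h1 h2 => ?_⟩
  rw [Equiv.Perm.mul_apply, Equiv.Perm.mul_apply, Equiv.Perm.inv_eq_iff_eq]
  refine hs.fix _ (fun t e => h1 t ?_) fun t e => h2 t ?_
  · exact h.injective (e.trans (hu t).symm)
  · exact h.injective (e.trans (hv t).symm)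

/-! ### The Higman generators -/

theorem higmanGenerators_finite : higmanGenerators.Finite := by
  have : higmanGenerators = ⋃ T ∈ higmanTables.toFinset, {g | HasTable g T} := by
    ext g
    simp [higmanGenerators]
  rw [this]
  refine Set.Finite.biUnion (Finset.finite_toSet _) fun T hT => Set.Subsingleton.finite ?_
  intro g hg h hh
  exact (existsUnique_hasTable T (List.mem_toFinset.1 hT)).unique hg hh

/-- Each Higman table covers the words of length two and is its own inverse. -/
theorem higmanTables_entry : ∀ T ∈ higmanTables, ∀ a b : Bool,
    ∃ e ∈ T, (e.2, e.1) ∈ T ∧ e.1 <+: [a, b] := by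
  simp only [higmanTables, List.forall_mem_cons]
  exact ⟨by decide, by decide, by decide, by decide, by simp⟩

theorem mul_self_of_mem_higmanGenerators {g : thompsonV} (hg : g ∈ higmanGenerators) :
    g * g = 1 := by
  obtain ⟨T, hT, h⟩ := hg
  ext1
  ext1 x
  obtain ⟨a, b, t, rfl⟩ := cantor_cases x
  obtain ⟨e, he, he', r, hr⟩ := higmanTables_entry T hT a b
  rw [← hr]
  exact ((h _ he').comp (h _ he)).append r t

theorem inv_eq_of_mem_higmanGenerators {g : thompsonV} (hg : g ∈ higmanGenerators) :
    g⁻¹ = g := inv_eq_of_mul_eq_one_left (mul_self_of_mem_higmanGenerators hg)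

theorem length_le_two_of_mem_higmanGenerators {g : thompsonV} (hg : g ∈ higmanGenerators)
    {x : List Bool} (hx : x ∈ domC g) : x.length ≤ 2 := by
  obtain ⟨T, hT, h⟩ := hg
  refine idealCode_length_le (fun y hy => ?_) hx
  obtain ⟨a, b, rfl⟩ := List.length_eq_two.1 hy
  obtain ⟨e, he, -, r, hr⟩ := higmanTables_entry T hT a b
  exact ⟨e.2 ++ r, hr ▸ (h _ he).append r⟩

/-- The partial action of the Higman generators on finite words. -/
def higmanAct : Fin 4 → List Bool → Option (List Bool)
  | 0, false :: x => some (true :: x)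
  | 0, true :: x => some (false :: x)
  | 1, false :: false :: x => some (false :: false :: x)
  | 1, false :: true :: x => some (true :: x)
  | 1, true :: x => some (false :: true :: x)
  | 2, false :: x => some (true :: false :: x)
  | 2, true :: false :: x => some (false :: x)
  | 2, true :: true :: x => some (true :: true :: x)
  | 3, false :: false :: x => some (false :: false :: x)
  | 3, false :: true :: x => some (true :: false :: x)
  | 3, true :: false :: x => some (false :: true :: x)
  | 3, true :: true :: x => some (true :: true :: x)
  | _, _ => none

theorem exists_maps_of_higmanAct (i : Fin 4) : ∃ g ∈ higmanGenerators,
    ∀ u v, higmanAct i u = some v → Maps g u v := by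
  obtain ⟨g, hg, -⟩ := existsUnique_hasTable (higmanTables[i]) (List.getElem_mem _)
  refine ⟨g, ⟨_, List.getElem_mem _, hg⟩, fun u v h => ?_⟩
  have key : ∃ e ∈ higmanTables[i], ∃ r, u = e.1 ++ r ∧ v = e.2 ++ r := by
    unfold higmanAct at h
    split at h <;> simp only [Option.some.injEq, reduceCtorEq] at h <;> subst h <;>
      simp [higmanTables]
  obtain ⟨e, he, r, rfl, rfl⟩ := key
  exact (hg e he).append r

/-- The partial action of words over the Higman generators (first letter first). -/
def higmanActWord : List (Fin 4) → List Bool → Option (List Bool)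
  | [], u => some u
  | i :: l, u => (higmanAct i u).bind (higmanActWord l)

/-! ### Exchanges of two cones, obtained from the Higman generators -/

/-- The subgroup generated by the Higman generators contains the exchange of `u` and `v`. -/
def HasSwap (u v : List Bool) : Prop :=
  ∃ h ∈ Subgroup.closure higmanGenerators, IsSwap h u v

theorem HasSwap.symm {u v : List Bool} (h : HasSwap u v) : HasSwap v u :=
  h.imp fun _ h => ⟨h.1, h.2.symm⟩

/-- Conjugating an exchange by the generators in `l` pulls it back along their action. This reduces
a pair of words to a shorter pair. -/
theorem HasSwap.of_act (l : List (Fin 4)) {u v u' v' : List Bool} (h : HasSwap u' v')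
    (hu : higmanActWord l u = some u') (hv : higmanActWord l v = some v') : HasSwap u v := by
  induction l generalizing u v with
  | nil =>
    obtain rfl : u = u' := by simpa [higmanActWord] using hu
    obtain rfl : v = v' := by simpa [higmanActWord] using hv
    exact h
  | cons i l ih =>
    obtain ⟨u₁, hu₁, hu₂⟩ := Option.bind_eq_some_iff.1 hu
    obtain ⟨v₁, hv₁, hv₂⟩ := Option.bind_eq_some_iff.1 hv
    obtain ⟨s, hs, hswap⟩ := ih hu₂ hv₂
    obtain ⟨g, hg, hact⟩ := exists_maps_of_higmanAct i
    have hg' := Subgroup.subset_closure hg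
    exact ⟨g⁻¹ * s * g, mul_mem (mul_mem (inv_mem hg') hs) hg',
      hswap.conj (hact _ _ hu₁) (hact _ _ hv₁)⟩

theorem hasSwap_of_table {u v : List Bool} (i : Fin 4) (hu : higmanAct i u = some v)
    (hv : higmanAct i v = some u)
    (h : ∀ a b, u <+: [a, b] ∨ v <+: [a, b] ∨ higmanAct i [a, b] = some [a, b]) :
    HasSwap u v := by
  obtain ⟨g, hg, hact⟩ := exists_maps_of_higmanAct i
  refine ⟨g, Subgroup.subset_closure hg, hact _ _ hu, hact _ _ hv, fun x h1 h2 => ?_⟩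
  obtain ⟨a, b, t, rfl⟩ := cantor_cases x
  rcases h a b with ⟨r, hr⟩ | ⟨r, hr⟩ | h
  · exact absurd (hr ▸ Stream'.append_append_stream u r t) (h1 _)
  · exact absurd (hr ▸ Stream'.append_append_stream v r t) (h2 _)
  · exact hact _ _ h t

theorem hasSwap_0_1 : HasSwap [false] [true] :=
  hasSwap_of_table 0 rfl rfl (by decide)

theorem hasSwap_01_1 : HasSwap [false, true] [true] :=
  hasSwap_of_table 1 rfl rfl (by decide)

theorem hasSwap_0_10 : HasSwap [false] [true, false] :=
  hasSwap_of_table 2 rfl rfl (by decide)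

/-- The pairs of words that start with different letters. -/
theorem hasSwap_cons_false_cons_true (n : ℕ)
    (ih : ∀ u v : List Bool, u.length + v.length < n → ¬ u <+: v → ¬ v <+: u → HasSwap u v) :
    ∀ u v : List Bool, u.length + v.length + 2 = n → HasSwap (false :: u) (true :: v) := by
  intro u v hn
  match u, v, hn with
  | [], [], _ => exact hasSwap_0_1
  | [], [false], _ => exact hasSwap_0_10
  | [], [true], _ => exact hasSwap_01_1.symm.of_act [0] rfl rfl
  -- In this and the later inductive cases, the listed generators carry the pair to an incomparable
  -- pair of smaller total length.
  | [], false :: false :: y, hn =>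
    exact (ih (true :: []) (false :: false :: y) (by simp at hn ⊢; omega) (by simp)
      (by simp)).of_act [2, 3, 1] rfl rfl
  | [], false :: true :: y, hn =>
    exact (ih (true :: true :: []) (false :: y) (by simp at hn ⊢; omega) (by simp)
      (by simp)).of_act [0, 1, 0, 2, 3, 2] rfl rfl
  | [], true :: false :: y, hn =>
    exact (ih (false :: false :: []) (true :: y) (by simp at hn ⊢; omega) (by simp)
      (by simp)).of_act [2, 0, 1, 3, 1] rfl rfl
  | [], true :: true :: y, hn =>
    exact (ih (false :: []) (true :: true :: y) (by simp at hn ⊢; omega) (by simp)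
      (by simp)).of_act [0, 1, 3, 2] rfl rfl
  | [false], [], _ => exact hasSwap_0_10.symm.of_act [0] rfl rfl
  | [true], [], _ => exact hasSwap_01_1
  | false :: false :: x, [], hn =>
    exact (ih (false :: false :: x) (true :: []) (by simp at hn ⊢; omega) (by simp)
      (by simp)).of_act [0, 2, 3, 1] rfl rfl
  | false :: true :: x, [], hn =>
    exact (ih (false :: x) (true :: true :: []) (by simp at hn ⊢; omega) (by simp)
      (by simp)).of_act [1, 0, 2, 3, 2] rfl rfl
  | true :: false :: x, [], hn =>
    exact (ih (true :: x) (false :: false :: []) (by simp at hn ⊢; omega) (by simp)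
      (by simp)).of_act [0, 2, 0, 1, 3, 1] rfl rfl
  | true :: true :: x, [], hn =>
    exact (ih (true :: true :: x) (false :: []) (by simp at hn ⊢; omega) (by simp)
      (by simp)).of_act [1, 3, 2] rfl rfl
  | false :: x, false :: y, hn =>
    exact (ih (false :: false :: x) (true :: y) (by simp at hn ⊢; omega) (by simp)
      (by simp)).of_act [3, 1] rfl rfl
  | false :: x, true :: y, hn =>
    exact (ih (false :: x) (true :: true :: y) (by simp at hn ⊢; omega) (by simp)
      (by simp)).of_act [1, 0, 2, 0, 1, 3, 2] rfl rfl
  | true :: x, false :: y, hn =>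
    exact (ih (false :: false :: x) (true :: y) (by simp at hn ⊢; omega) (by simp)
      (by simp)).of_act [1, 0, 2, 0, 1, 3, 1] rfl rfl
  | true :: x, true :: y, hn =>
    exact (ih (false :: x) (true :: true :: y) (by simp at hn ⊢; omega) (by simp)
      (by simp)).of_act [3, 2] rfl rfl

theorem hasSwap (u v : List Bool) (huv : ¬ u <+: v) (hvu : ¬ v <+: u) : HasSwap u v := by
  induction hn : u.length + v.length using Nat.strong_induction_on generalizing u v with
  | _ n ih =>
  replace ih : ∀ u v : List Bool, u.length + v.length < n → ¬ u <+: v → ¬ v <+: u →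
      HasSwap u v := fun u v h h1 h2 => ih _ h u v h1 h2 rfl
  match u, v, hn, huv, hvu with
  | [], _, _, h, _ => exact absurd (List.nil_prefix) h
  | _, [], _, _, h => exact absurd (List.nil_prefix) h
  -- A one-letter word is incomparable only with words that start with the other letter.
  | [a], b :: y, _, h, h' =>
    have hab : a ≠ b := by rintro rfl; exact h ⟨y, rfl⟩
    cases a <;> cases b <;> try exact absurd rfl hab
    · exact hasSwap_cons_false_cons_true n ih _ _ (by simp at *; omega)
    · exact (hasSwap_cons_false_cons_true n ih _ _ (by simp at *; omega)).symm
  | b :: y, [a], _, h, h' =>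
    have hab : a ≠ b := by rintro rfl; exact h' ⟨y, rfl⟩
    cases a <;> cases b <;> try exact absurd rfl hab
    · exact (hasSwap_cons_false_cons_true n ih _ _ (by simp at *; omega)).symm
    · exact hasSwap_cons_false_cons_true n ih _ _ (by simp at *; omega)
  | false :: _, true :: _, hn, _, _ =>
    exact hasSwap_cons_false_cons_true n ih _ _ (by simp at *; omega)
  | true :: _, false :: _, hn, _, _ =>
    exact (hasSwap_cons_false_cons_true n ih _ _ (by simp at *; omega)).symm
  | false :: false :: x, false :: false :: y, hn, h, h' =>
    exact (ih (false :: x) (false :: y) (by simp at hn ⊢; omega) (by simpa using h)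
      (by simpa using h')).of_act [0, 2] rfl rfl
  | false :: false :: x, false :: true :: y, hn, h, h' =>
    exact (ih (false :: false :: x) (true :: y) (by simp at hn ⊢; omega) (by simp)
      (by simp)).of_act [1] rfl rfl
  | false :: true :: x, false :: false :: y, hn, h, h' =>
    exact (ih (true :: x) (false :: false :: y) (by simp at hn ⊢; omega) (by simp)
      (by simp)).of_act [1] rfl rfl
  | false :: true :: x, false :: true :: y, hn, h, h' =>
    exact (ih (true :: x) (true :: y) (by simp at hn ⊢; omega) (by simpa using h)
      (by simpa using h')).of_act [1] rfl rfl
  | true :: false :: x, true :: false :: y, hn, h, h' =>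
    exact (ih (false :: x) (false :: y) (by simp at hn ⊢; omega) (by simpa using h)
      (by simpa using h')).of_act [2] rfl rfl
  | true :: false :: x, true :: true :: y, hn, h, h' =>
    exact (ih (false :: x) (true :: true :: y) (by simp at hn ⊢; omega) (by simp)
      (by simp)).of_act [2] rfl rfl
  | true :: true :: x, true :: false :: y, hn, h, h' =>
    exact (ih (true :: true :: x) (false :: y) (by simp at hn ⊢; omega) (by simp)
      (by simp)).of_act [2] rfl rfl
  | true :: true :: x, true :: true :: y, hn, h, h' =>
    exact (ih (true :: x) (true :: y) (by simp at hn ⊢; omega) (by simpa using h)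
      (by simpa using h')).of_act [0, 1] rfl rfl


/-! ### Generation of `V` by exchanges of cones -/

/-- Every infinite bitstring has a prefix in `P`. -/
def Covers (P : Set (List Bool)) : Prop :=
  ∀ x : Cantor, ∃ p ∈ P, ∃ t, x = p ++ₛ t

/-- The sibling of a longest code word must be covered, and a shorter code word covering it would be
a prefix of that longest word. -/
theorem exists_siblings {P : Finset (List Bool)} (hP : IsPrefixCode (P : Set (List Bool)))
    (hc : Covers (P : Set (List Bool))) (hnil : [] ∉ P) :
    ∃ u, ∀ b, u ++ [b] ∈ P := by
  obtain ⟨p₀, hp₀, -⟩ := hc zeros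
  obtain ⟨p, hp, hmax⟩ := P.exists_max_image List.length ⟨p₀, hp₀⟩
  rcases List.eq_nil_or_concat' p with rfl | ⟨u, c, rfl⟩
  · exact absurd hp hnil
  refine ⟨u, fun b => ?_⟩
  by_cases hbc : b = c
  · exact hbc ▸ hp
  obtain ⟨q, hq, t, ht⟩ := hc ((u ++ [b]) ++ₛ zeros)
  have hq' : q <+: u ++ [b] :=
    prefix_of_append_stream (by simpa using hmax q hq) ht.symm
  rcases List.prefix_concat_iff.1 hq' with h | h
  · exact h ▸ hq
  · have h1 := hP q hq _ hp (h.trans (List.prefix_append _ _))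
    have h2 := h.length_le
    simp [h1] at h2

/-- Permutation of a prefix code by an exchange. -/
theorem exists_swap_mem {Q : Set (List Bool)} (hQ : IsPrefixCode Q) {a b : List Bool}
    (ha : a ∈ Q) (hb : b ∈ Q) :
    ∃ s ∈ Subgroup.closure higmanGenerators, Maps s a b ∧ Maps s b a ∧
      ∀ c ∈ Q, c ≠ a → c ≠ b → Maps s c c := by
  by_cases hab : a = b
  · subst hab
    exact ⟨1, one_mem _, Maps.one _, Maps.one _, fun c _ _ _ => Maps.one _⟩
  obtain ⟨s, hs, hsw⟩ := hasSwap a b (fun h => hab (hQ a ha b hb h))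
    (fun h => hab (hQ b hb a ha h).symm)
  refine ⟨s, hs, hsw.left, hsw.right, fun c hc hca hcb t => hsw.fix _ ?_ ?_⟩
  · intro r e
    exact hca ((prefix_or_prefix_of_append_stream e).elim (hQ c hc a ha)
      fun h => (hQ a ha c hc h).symm)
  · intro r e
    exact hcb ((prefix_or_prefix_of_append_stream e).elim (hQ c hc b hb)
      fun h => (hQ b hb c hc h).symm)

theorem exists_swap_mem_image {Q : Set (List Bool)} (hQ : IsPrefixCode Q) {a b : List Bool}
    (ha : a ∈ Q) (hb : b ∈ Q) :
    ∃ s ∈ Subgroup.closure higmanGenerators, Maps s a b ∧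
      (∀ c ∈ Q, c ≠ a → c ≠ b → Maps s c c) ∧ ∀ c ∈ Q, ∃ d ∈ Q, Maps s c d := by
  obtain ⟨s, hs, hab, hba, h⟩ := exists_swap_mem hQ ha hb
  refine ⟨s, hs, hab, h, fun c hc => ?_⟩
  by_cases h1 : c = a
  · exact ⟨b, hb, h1 ▸ hab⟩
  by_cases h2 : c = b
  · exact ⟨a, ha, h2 ▸ hba⟩
  exact ⟨c, hc, h c hc h1 h2⟩

/-- Induction on the size of the domain code. Two exchanges make the images of two sibling words
into siblings, in the right order; the two rows then merge into one. -/
theorem mem_closure_higmanGenerators_of_code (n : ℕ) (P : Finset (List Bool)) (hn : P.card = n)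
    (hP : IsPrefixCode (P : Set (List Bool))) (hc : Covers (P : Set (List Bool)))
    (g : thompsonV) (hg : ∀ p ∈ P, ∃ v, Maps g p v) :
    g ∈ Subgroup.closure higmanGenerators := by
  induction n generalizing P g with
  | zero =>
    obtain ⟨p, hp, -⟩ := hc zeros
    simp [Finset.card_eq_zero.1 hn] at hp
  | succ n ih =>
  by_cases hnil : [] ∈ P
  · obtain ⟨v, hv⟩ := hg _ hnil
    obtain rfl : g = 1 := Subtype.ext (eq_one_of_maps_nil hv)
    exact one_mem _
  choose! f hf using hg
  have hQ : IsPrefixCode (P.image f : Finset (List Bool)) := by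
    intro y hy z hz hyz
    obtain ⟨p, hp, rfl⟩ := Finset.mem_image.1 (Finset.mem_coe.1 hy)
    obtain ⟨q, hq, rfl⟩ := Finset.mem_image.1 (Finset.mem_coe.1 hz)
    exact congrArg f (((hf p hp).prefix_or_prefix (hf q hq) hyz).elim (hP p hp q hq)
      fun h => (hP q hq p hp h).symm)
  have hQc : Covers (P.image f : Finset (List Bool)) := fun x => by
    obtain ⟨p, hp, t, ht⟩ := hc ((g : Equiv.Perm Cantor).symm x)
    exact ⟨f p, Finset.mem_coe.2 (Finset.mem_image_of_mem f hp), t,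
      by rw [← hf p hp, ← ht, Equiv.apply_symm_apply]⟩
  have hQnil : [] ∉ P.image f := by
    intro h
    obtain ⟨p, hp, hfp⟩ := Finset.mem_image.1 h
    exact hnil (eq_nil_of_maps_nil_right (hfp ▸ hf p hp) ▸ hp)
  obtain ⟨u, hu⟩ := exists_siblings hP hc hnil
  obtain ⟨v, hv⟩ := exists_siblings hQ hQc hQnil
  have hfu : ∀ b, f (u ++ [b]) ∈ P.image f := fun b => Finset.mem_image_of_mem f (hu b)
  -- `s` brings the image of `u0` to `v0` and that of `u1` to some `a`. Then `r` brings `a` to `v1`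
  -- and leaves `v0` in place.
  obtain ⟨s, hs, hsm, -, hsQ⟩ := exists_swap_mem_image hQ (hfu false) (hv false)
  obtain ⟨a, haQ, ha⟩ := hsQ _ (hfu true)
  have hne : v ++ [false] ≠ a := by
    intro h
    subst h
    have h1 := (hsm.comp (hf _ (hu false))).prefix_or_prefix (ha.comp (hf _ (hu true)))
      List.prefix_rfl
    simp at h1
  obtain ⟨r, hr, hrm, hrfix, hrQ⟩ := exists_swap_mem_image hQ haQ (hv true)
  have hmap : ∀ p ∈ P, ∃ w, Maps (r * s * g : thompsonV) p w := fun p hp => by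
    obtain ⟨b, hbQ, hb⟩ := hsQ _ (Finset.mem_image_of_mem f hp)
    obtain ⟨c, -, hc⟩ := hrQ b hbQ
    exact ⟨c, (hc.comp hb).comp (hf p hp)⟩
  have huv : Maps (r * s * g : thompsonV) u v := by
    refine Maps.of_children fun b => ?_
    cases b
    · exact ((hrfix _ (hv false) hne (by simp)).comp hsm).comp (hf _ (hu false))
    · exact (hrm.comp ha).comp (hf _ (hu true))
  have hmem : ∀ p, p ∈ insert u ((P.erase (u ++ [false])).erase (u ++ [true])) ↔
      p = u ∨ p ∈ P ∧ ∀ b, p ≠ u ++ [b] := by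
    intro p
    simp only [Finset.mem_insert, Finset.mem_erase, Bool.forall_bool]
    tauto
  have key : r * s * g ∈ Subgroup.closure higmanGenerators := by
    refine ih (insert u ((P.erase (u ++ [false])).erase (u ++ [true]))) ?_ ?_ ?_ _ ?_
    · have huP : u ∉ P := fun h => by
        have := hP u h _ (hu true) (List.prefix_append _ _)
        simp at this
      rw [Finset.card_insert_of_notMem (by simp [huP]),
        Finset.card_erase_of_mem (by simp [hu true]), Finset.card_erase_of_mem (hu false), hn]
      have : 1 < P.card := Finset.one_lt_card.2 ⟨_, hu false, _, hu true, by simp⟩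
      omega
    · intro p hp q hq hpq
      rcases (hmem p).1 hp with rfl | ⟨hpP, hpu⟩ <;>
        rcases (hmem q).1 hq with rfl | ⟨hqP, hqu⟩
      · rfl
      · obtain ⟨_ | ⟨b, x⟩, rfl⟩ := hpq
        · simp
        · refine absurd (hP _ (hu b) _ hqP ⟨x, by simp⟩).symm (hqu b)
      · exact absurd (hP _ hpP _ (hu true) (hpq.trans (List.prefix_append _ _))) (hpu true)
      · exact hP p hpP q hqP hpq
    · intro x
      obtain ⟨p, hp, t, ht⟩ := hc x
      by_cases h : ∀ b, p ≠ u ++ [b]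
      · exact ⟨p, (hmem p).2 (.inr ⟨hp, h⟩), t, ht⟩
      · push Not at h
        obtain ⟨b, rfl⟩ := h
        exact ⟨u, (hmem u).2 (.inl rfl), [b] ++ₛ t, by rw [ht, Stream'.append_append_stream]⟩
    · intro p hp
      rcases (hmem p).1 hp with rfl | ⟨hp, -⟩
      · exact ⟨v, huv⟩
      · exact hmap p hp
  exact (Subgroup.mul_mem_cancel_left _ (mul_mem hr hs)).1 key

theorem closure_higmanGenerators : Subgroup.closure higmanGenerators = ⊤ := by
  refine eq_top_iff.2 fun g _ => ?_
  obtain ⟨P, Q, β, hP, -, h⟩ := g.2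
  exact mem_closure_higmanGenerators_of_code _ P rfl hP.1 (exists_prefix hP) g
    fun p hp => ⟨_, h ⟨p, hp⟩⟩

/-- The generators are involutions, so the monoid they generate is already the group. -/
theorem isMonoidGeneratingSet_higmanGenerators : IsMonoidGeneratingSet higmanGenerators := by
  have hinv : higmanGenerators⁻¹ = higmanGenerators := by
    ext g
    rw [Set.mem_inv]
    refine ⟨fun h => ?_, fun h => (inv_eq_of_mem_higmanGenerators h).symm ▸ h⟩
    rw [← inv_inv g, inv_eq_of_mem_higmanGenerators h]
    exact h
  have h := Subgroup.closure_toSubmonoid higmanGenerators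
  rw [hinv, Set.union_self, closure_higmanGenerators] at h
  exact h.symm


/-! ### The co-word-problem as a cyclic closure -/

theorem Maps.unique {g : Equiv.Perm Cantor} {u v v' : List Bool} (h : Maps g u v)
    (h' : Maps g u v') : v = v' := by
  have key : ∀ {v v' : List Bool}, Maps g u v → Maps g u v' → v.length ≤ v'.length →
      v = v' := by
    intro v v' h h' hl
    obtain ⟨r, rfl⟩ := prefix_of_append_stream hl ((h zeros).symm.trans (h' zeros))
    have hr : Maps 1 [] r := fun t => by
      have := (h t).symm.trans (h' t)
      rw [Stream'.append_append_stream] at this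
      exact append_stream_left_injective v this
    rw [eq_nil_of_maps_nil_right hr.inv, List.append_nil]
  exact (le_total v.length v'.length).elim (key h h') fun hl => (key h' h hl).symm

theorem replicate_append_zeros (n : ℕ) : List.replicate n false ++ₛ zeros = zeros := by
  induction n with
  | zero => rfl
  | succ n ih =>
    rw [List.replicate_succ, Stream'.cons_append_stream, ih]
    exact (Stream'.const_eq false).symm

theorem append_zeros_eq_zeros {r : List Bool} {t : Cantor} (h : r ++ₛ t = zeros) :
    r = List.replicate r.length false ∧ t = zeros :=
  append_stream_inj (by simp) (h.trans (replicate_append_zeros r.length).symm)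

/-- A table `E` of a permutation in which no row moves the left end of its cone has no row
that strictly expands its cone. -/
theorem not_expanding_of_fixes_left_ends {g : Equiv.Perm Cantor}
    {E : Set (List Bool × List Bool)} (hg : ∀ e ∈ E, Maps g e.1 e.2)
    (hfix : ∀ e ∈ E, e.1 ++ₛ zeros = e.2 ++ₛ zeros)
    (hcode : ∀ e ∈ E, ∀ e' ∈ E, e.1 <+: e'.1 → e = e')
    (hcov : ∀ x : Cantor, ∃ e ∈ E, ∃ t, x = e.1 ++ₛ t)
    {v : List Bool} {n : ℕ} (h : (v ++ List.replicate (n + 1) false, v) ∈ E) : False := by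
  set c := v ++ List.replicate n false with hc
  have hu : v ++ List.replicate (n + 1) false = c ++ [false] := by
    rw [hc, List.replicate_succ', List.append_assoc]
  rw [hu] at h
  have hne : ∀ s t : Cantor, (c ++ [true]) ++ₛ s ≠ (c ++ [false]) ++ₛ t := fun s t e => by
    simpa using (append_stream_inj (by simp) e).1
  -- The row covering `c 1 0^ω` cannot start above `c`, since it would then be the row of `c0`. So
  -- its domain word is `c1` followed by zeros, and `c 1 0^ω` is a fixed left end.
  obtain ⟨e, he, t, ht⟩ := hcov ((c ++ [true]) ++ₛ zeros)
  have hpre : ¬ e.1 <+: c := fun hp =>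
    hne _ _ (ht.trans (by rw [hcode e he _ h (hp.trans (List.prefix_append _ _))]))
  have hpre' : c ++ [true] <+: e.1 := by
    rcases prefix_or_prefix_of_append_stream ht with h | h
    · exact h
    · rcases List.prefix_concat_iff.1 h with h | h
      · exact h ▸ List.prefix_rfl
      · exact absurd h hpre
  obtain ⟨r, hr⟩ := hpre'
  rw [← hr, Stream'.append_append_stream _ r] at ht
  obtain ⟨-, rfl⟩ := append_zeros_eq_zeros (append_stream_left_injective _ ht).symm
  have hy : (c ++ [true]) ++ₛ zeros = e.1 ++ₛ zeros := by
    rw [← hr, Stream'.append_append_stream _ r]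
    exact ht
  have h1 : g ((c ++ [true]) ++ₛ zeros) = (c ++ [true]) ++ₛ zeros := by
    rw [hy, hg e he, hfix e he]
  -- The expanding row also sends a point below `c0` to `v 0^n 1 0^ω = c 1 0^ω`, against
  -- injectivity.
  have h2 := hg _ h (List.replicate n false ++ ([true] : List Bool) ++ₛ zeros)
  rw [← Stream'.append_append_stream v, ← List.append_assoc, ← hc, ← h1] at h2
  exact hne _ _ (g.injective h2).symm

/-- The two words of a row have the same left end, so they differ by trailing zeros only. Expanding
rows are excluded directly, contracting ones by passing to the inverse with the swapped table. -/
theorem eq_one_of_fixes_left_ends {g : Equiv.Perm Cantor}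
    {E : Set (List Bool × List Bool)} (hg : ∀ e ∈ E, Maps g e.1 e.2)
    (hfix : ∀ e ∈ E, e.1 ++ₛ zeros = e.2 ++ₛ zeros)
    (hcode : ∀ e ∈ E, ∀ e' ∈ E, e.1 <+: e'.1 → e = e')
    (hcov : ∀ x : Cantor, ∃ e ∈ E, ∃ t, x = e.1 ++ₛ t) : g = 1 := by
  have hrow : ∀ e ∈ E, e.1 = e.2 := by
    rintro ⟨u, v⟩ he
    rcases prefix_or_prefix_of_append_stream (hfix _ he) with ⟨r, hr⟩ | ⟨r, hr⟩
    · have h1 := hfix _ he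
      simp only at hr h1
      rw [← hr, Stream'.append_append_stream] at h1
      have h2 := (append_zeros_eq_zeros (append_stream_left_injective _ h1).symm).1
      generalize r.length = n at h2
      subst h2
      cases n with
      | zero => simpa using hr
      | succ n =>
        refine (not_expanding_of_fixes_left_ends (g := g⁻¹) (E := Prod.swap ⁻¹' E) (v := u)
          (n := n) (fun e he => (hg _ he).inv) (fun e he => (hfix _ he).symm) ?_ ?_ ?_).elim
        · intro e he e' he' hp
          refine Prod.swap_injective ?_
          exact ((hg _ he).prefix_or_prefix (hg _ he') hp).elim (hcode _ he _ he')
            fun h => (hcode _ he' _ he h).symm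
        · intro x
          obtain ⟨e, he, t, ht⟩ := hcov (g.symm x)
          refine ⟨e.swap, by simpa using he, t, ?_⟩
          rw [Prod.fst_swap, ← hg e he, ← ht, Equiv.apply_symm_apply]
        · rw [hr]
          exact he
    · have h1 := hfix _ he
      simp only at hr h1
      rw [← hr, Stream'.append_append_stream] at h1
      have h2 := (append_zeros_eq_zeros (append_stream_left_injective _ h1)).1
      generalize r.length = n at h2
      subst h2
      cases n with
      | zero => simpa using hr.symm
      | succ n =>
        exact (not_expanding_of_fixes_left_ends (v := v) (n := n) hg hfix hcode hcov
          (by rw [hr]; exact he)).elim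
  ext1 x
  obtain ⟨e, he, t, rfl⟩ := hcov x
  rw [hg e he, hrow e he]
  rfl

/-! ### Letter-by-letter runs on finite words -/

/-- The word `w` maps `u` to `v` letter by letter, without extending `u`. -/
def Run {Γ : Set thompsonV} : List Γ → List Bool → List Bool → Prop
  | [], u, v => u = v
  | a :: w, u, v => ∃ x, Run w u x ∧ Maps (a : thompsonV) x v

variable {Γ : Set thompsonV}

theorem Run.maps {w : List Γ} {u v : List Bool} (h : Run w u v) :
    Maps (wordValue w : thompsonV) u v := by
  induction w generalizing v with
  | nil => exact h ▸ Maps.one u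
  | cons a w ih =>
    obtain ⟨x, hx, hv⟩ := h
    exact hv.comp (ih hx)

theorem Run.append {w : List Γ} {u v : List Bool} (h : Run w u v) (r : List Bool) :
    Run w (u ++ r) (v ++ r) := by
  induction w generalizing v with
  | nil => exact congrArg (· ++ r) h
  | cons a w ih =>
    obtain ⟨x, hx, hv⟩ := h
    exact ⟨x ++ r, ih hx, hv.append r⟩

theorem exists_run (w : List Γ) : ∃ N, ∀ u : List Bool, u.length = N → ∃ v, Run w u v := by
  induction w with
  | nil => exact ⟨0, fun u _ => ⟨u, rfl⟩⟩
  | cons a w ih =>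
    obtain ⟨N, hN⟩ := ih
    obtain ⟨M, hM⟩ := (isThompson_iff _).1 (a : thompsonV).2
    refine ⟨N + M, fun u hu => ?_⟩
    obtain ⟨v, hv⟩ := hN (u.take N) (by simp [hu])
    have h1 := hv.append (u.drop N)
    rw [List.take_append_drop] at h1
    set x := v ++ u.drop N with hx
    obtain ⟨y, hy⟩ := hM (x.take M) (by simp [hx, hu])
    have h2 := Maps.append hy (x.drop M)
    rw [List.take_append_drop] at h2
    exact ⟨_, x, h1, h2⟩

/-- If the parent of a word cannot be processed by `w`, then at some point of the process a word
of a domain code occurs. -/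
theorem Run.parent_or_domC {w : List Γ} {p v : List Bool} {b : Bool} (h : Run w (p ++ [b]) v) :
    (∃ v', v = v' ++ [b] ∧ Run w p v') ∨
      ∃ (y : List Γ) (a : Γ) (x : List Γ) (z : List Bool), w = y ++ a :: x ∧ z ∈ domC (a : thompsonV) ∧ Run x (p ++ [b]) z := by
  induction w generalizing v with
  | nil => exact .inl ⟨p, h.symm, rfl⟩
  | cons a w ih =>
    obtain ⟨x, hx, hv⟩ := h
    rcases ih hx with ⟨x', rfl, hx'⟩ | ⟨y, a', x', z, rfl, hz, hr⟩
    · by_cases hd : x' ∈ Dom (a : thompsonV)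
      · obtain ⟨v', hv'⟩ := hd
        exact .inl ⟨v', hv.unique (hv'.append [b]), x', hx', hv'⟩
      -- Every strict prefix of `x' ++ [b]` is a prefix of `x'`, which is outside the domain of `a`.
      · refine .inr ⟨[], a, w, x' ++ [b], rfl, ⟨⟨v, hv⟩, fun y hy hyx => ?_⟩, hx⟩
        rcases List.prefix_concat_iff.1 hyx with h | ⟨r, rfl⟩
        · exact h
        · obtain ⟨q, hq⟩ := hy
          exact absurd ⟨_, Maps.append hq r⟩ hd
    · exact .inr ⟨a :: y, a', x', z, rfl, hz, hr⟩

theorem wordValue_append (x y : List Γ) : wordValue (x ++ y) = wordValue x * wordValue y := by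
  simp [wordValue]

theorem wordValue_eq_one_of_cyclic_shifts_fix (m : ℕ)
    (hm : ∀ a ∈ Γ, ∀ z ∈ domC a, z.length ≤ m) (w : List Γ)
    (h : ∀ x y : List Γ, w = y ++ x → ∀ z : List Bool, z.length = m →
      ((wordValue (x ++ y) : thompsonV) : Equiv.Perm Cantor) (z ++ₛ zeros) = z ++ₛ zeros) :
    wordValue w = 1 := by
  by_cases hnil : ∃ v, Run w [] v
  · obtain ⟨v, hv⟩ := hnil
    exact Subtype.ext (eq_one_of_maps_nil hv.maps)
  have hfix : ∀ p b v, Run w (p ++ [b]) v → (¬ ∃ v', Run w p v') →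
      ((wordValue w : thompsonV) : Equiv.Perm Cantor) ((p ++ [b]) ++ₛ zeros) = (p ++ [b]) ++ₛ zeros := by
    intro p b v hv hp
    rcases hv.parent_or_domC with ⟨v', -, h'⟩ | ⟨y, a, x, z, rfl, hz, hr⟩
    · exact absurd ⟨v', h'⟩ hp
    have hzm := hm a a.2 z hz
    -- Padding `z` with zeros to length `m` does not change `z 0^ω`. This point is the image of `(p
    -- ++ [b]) 0^ω` under `x`, so cancelling `x` on the left turns the shift's fixed point into one
    -- of `w`.
    have h1 := h x (y ++ [a]) (by simp) (z ++ List.replicate (m - z.length) false)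
      (by simp; omega)
    rw [Stream'.append_append_stream, replicate_append_zeros, wordValue_append,
      ← hr.maps zeros, Subgroup.coe_mul, Equiv.Perm.mul_apply] at h1
    rw [List.append_cons, wordValue_append, Subgroup.coe_mul, Equiv.Perm.mul_apply]
    exact (Equiv.injective _ h1)
  refine Subtype.ext (eq_one_of_fixes_left_ends
    (E := {e | Run w e.1 e.2 ∧ ∀ p, p <+: e.1 → (∃ v, Run w p v) → p = e.1}) ?_ ?_ ?_ ?_)
  · exact fun e he => he.1.maps
  · rintro ⟨u, v⟩ ⟨he, hmin⟩
    rw [← he.maps]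
    rcases List.eq_nil_or_concat' u with rfl | ⟨p, b, rfl⟩
    · exact absurd ⟨v, he⟩ hnil
    · refine (hfix p b v he fun hp => ?_).symm
      simpa using hmin p (List.prefix_append _ _) hp
  · rintro ⟨u, v⟩ he ⟨u', v'⟩ he' hp
    obtain rfl : u = u' := he'.2 u hp ⟨v, he.1⟩
    exact congrArg (Prod.mk u) (he.1.maps.unique he'.1.maps)
  · intro x
    obtain ⟨N, hN⟩ := exists_run w
    have hex : ∃ n, ∃ v, Run w (x.take n) v := ⟨N, hN _ (by simp)⟩
    classical
    -- The covering row is given by the shortest prefix of `x` on which `w` runs.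
    obtain ⟨v, hv⟩ := Nat.find_spec hex
    refine ⟨(x.take (Nat.find hex), v), ⟨hv, fun p hp hpv => ?_⟩, x.drop (Nat.find hex),
      (Stream'.append_take_drop _ x).symm⟩
    refine hp.eq_of_length_le ?_
    rw [Stream'.length_take]
    refine Nat.find_min' hex ?_
    obtain ⟨r, hr⟩ := hp
    have h2 : x.take p.length = p := by
      have h3 := Stream'.append_take_drop (Nat.find hex) x
      rw [show x.take (Nat.find hex) = p ++ r from hr.symm, Stream'.append_append_stream] at h3
      have h4 := (Stream'.append_take_drop p.length x).trans h3.symm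
      exact (append_stream_inj (by simp) h4).1
    rwa [h2]

theorem coWordProblem_eq_cyc (m : ℕ) (hm : ∀ a ∈ Γ, ∀ z ∈ domC a, z.length ≤ m)
    {L : Language Γ} (hL : ∀ w, w ∈ L ↔ ∃ z : List Bool, z.length = m ∧ w ∈ movingLanguage Γ z) :
    coWordProblem Γ = cyc L := by
  ext w
  constructor
  · intro hw
    by_contra hcyc
    refine hw (wordValue_eq_one_of_cyclic_shifts_fix m hm w fun x y hxy z hz => ?_)
    by_contra hne
    exact hcyc ⟨x, y, (hL _).2 ⟨z, hz, hne⟩, hxy⟩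
  · rintro ⟨x, y, hxy, rfl⟩ h1
    obtain ⟨z, -, hz⟩ := (hL _).1 hxy
    have h2 : wordValue (y ++ x) = 1 := h1
    rw [wordValue_append, mul_eq_one_iff_eq_inv] at h2
    refine hz ?_
    rw [wordValue_append, h2, mul_inv_cancel]
    rfl


/-! ### A deterministic push-down automaton that follows the orbit of a point -/

/-! ### Finite representatives of the points `u 0^ω` -/

/-- The word has no trailing 0. -/
def NoTrailingZero (u : List Bool) : Prop := u.getLast? ≠ some false

theorem exists_noTrailingZero (u : List Bool) :
    ∃ v, NoTrailingZero v ∧ v ++ₛ zeros = u ++ₛ zeros := by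
  induction u using List.reverseRecOn with
  | nil => exact ⟨[], by simp [NoTrailingZero], rfl⟩
  | append_singleton u b ih =>
    cases b with
    | true => exact ⟨_, by simp [NoTrailingZero], rfl⟩
    | false =>
      obtain ⟨v, hv, h⟩ := ih
      refine ⟨v, hv, h.trans ?_⟩
      rw [Stream'.append_append_stream]
      exact congrArg _ (replicate_append_zeros 1).symm

theorem NoTrailingZero.length_le {u z : List Bool} (hu : NoTrailingZero u)
    (h : u ++ₛ zeros = z ++ₛ zeros) : u.length ≤ z.length := by
  rcases prefix_or_prefix_of_append_stream h with hp | ⟨r, rfl⟩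
  · exact hp.length_le
  · rw [Stream'.append_append_stream] at h
    have h2 := (append_zeros_eq_zeros (append_stream_left_injective _ h)).1
    generalize r.length = n at h2
    subst h2
    cases n with
    | zero => simp
    | succ n =>
      refine absurd ?_ hu
      rw [List.replicate_succ', ← List.append_assoc, List.getLast?_concat]

theorem exists_maps_of_length (hΓ : Γ.Finite) :
    ∃ N, ∀ a ∈ Γ, ∀ x : List Bool, x.length = N → ∃ y, Maps a x y := by
  have h : ∀ a : thompsonV, ∃ N, ∀ x : List Bool, x.length = N → ∃ y, Maps a x y :=
    fun a => (isThompson_iff _).1 a.2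
  choose N hN using h
  refine ⟨hΓ.toFinset.sup N, fun a ha x hx => ?_⟩
  have hle : N a ≤ x.length := hx ▸ Finset.le_sup (hΓ.mem_toFinset.2 ha)
  obtain ⟨y, hy⟩ := hN a (x.take (N a)) (by simpa using hle)
  refine ⟨y ++ x.drop (N a), ?_⟩
  have := hy.append (x.drop (N a))
  rwa [List.take_append_drop] at this

/-- Of the `K = N + (n + 1)` letters, all generators act on the first `N`; the other `n + 1` are
copied. The copied part makes the image longer than `n` and keeps the last letter of the whole stack
word. With `n = |z|`, the image cannot represent `z 0^ω`. -/
theorem exists_maps_of_long (hΓ : Γ.Finite) (n : ℕ) :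
    ∃ K, 0 < K ∧ ∀ (a : Γ) (c : List Bool), c.length = K → ∃ d, Maps (a : thompsonV) c d ∧
      n < d.length ∧ ∀ r, NoTrailingZero (c ++ r) → NoTrailingZero (d ++ r) := by
  obtain ⟨N, hN⟩ := exists_maps_of_length hΓ
  refine ⟨N + (n + 1), by omega, fun a c hc => ?_⟩
  obtain ⟨y, hy⟩ := hN a a.2 (c.take N) (by simp [hc])
  obtain ⟨x, e, hl, rfl⟩ : ∃ x e, e.length = n + 1 ∧ c = x ++ e :=
    ⟨c.take N, c.drop N, by simp [hc], (List.take_append_drop N c).symm⟩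
  obtain rfl : N = x.length := by simp at hc; omega
  rw [List.take_left] at hy
  refine ⟨y ++ e, hy.append e, by simp [hl]; omega, fun r hr => ?_⟩
  have hne : e ++ r ≠ [] := fun h => by simp_all
  rw [NoTrailingZero, List.append_assoc, List.getLast?_append_of_ne_nil _ hne] at hr ⊢
  exact hr

theorem exists_image_append_zeros (a : thompsonV) (u : List Bool) :
    ∃ v, NoTrailingZero v ∧ (a : Equiv.Perm Cantor) (u ++ₛ zeros) = v ++ₛ zeros := by
  obtain ⟨N, hN⟩ := (isThompson_iff _).1 a.2
  obtain ⟨y, hy⟩ := hN ((u ++ List.replicate N false).take N) (by simp)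
  obtain ⟨v, hv, h⟩ := exists_noTrailingZero (y ++ (u ++ List.replicate N false).drop N)
  refine ⟨v, hv, ?_⟩
  have := hy.append ((u ++ List.replicate N false).drop N) zeros
  rw [List.take_append_drop, Stream'.append_append_stream, replicate_append_zeros] at this
  exact this.trans h.symm

theorem map_some_append_eq {c u : List Bool} {t s : List (Option Bool)}
    (h : c.map some ++ t = u.map some ++ none :: s) :
    ∃ r, u = c ++ r ∧ t = r.map some ++ none :: s := by
  induction c generalizing u with
  | nil => exact ⟨u, rfl, h⟩
  | cons a c ih =>
    cases u with
    | nil => simp at h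
    | cons b u =>
      simp only [List.map_cons, List.cons_append, List.cons.injEq, Option.some.injEq] at h
      obtain ⟨r, rfl, hr⟩ := ih h.2
      exact ⟨r, by rw [h.1]; rfl, hr⟩

theorem map_some_append_none_eq {c u : List Bool} {t s : List (Option Bool)}
    (h : c.map some ++ none :: t = u.map some ++ none :: s) : u = c ∧ t = s := by
  obtain ⟨r, rfl, hr⟩ := map_some_append_eq h
  cases r with
  | nil => simpa using hr
  | cons b r => simp at hr

/-! ### The automaton and its determinism -/

open Classical in
/-- The transitions of the automaton that applies a letter `a` to a point `u 0^ω`, where `u` is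
the stack content above the bottom symbol `none`. If `u` has at least `K` letters, then its
prefix `c` of length `K` is replaced by `f a c`; otherwise, `u` is replaced by `h a u`. The state
tells whether the current point differs from `z 0^ω`. -/
noncomputable def orbitTransition (Γ : Set thompsonV) (z : List Bool) (f h : Γ → List Bool → List Bool) :
    Bool × Bool × Γ × List Bool → Transition Bool Γ (Option Bool)
  | (true, b, a, c) => ⟨b, c.map some, some a, true, (f a c).map some⟩
  | (false, b, a, c) => ⟨b, c.map some ++ [none], some a, decide (h a c ++ₛ zeros ≠ z ++ₛ zeros),
      (h a c).map some ++ [none]⟩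

theorem orbitTransition_src (z : List Bool) (f h : Γ → List Bool → List Bool)
    (e : Bool × Bool × Γ × List Bool) : (orbitTransition Γ z f h e).src = e.2.1 := by
  obtain ⟨_ | _, -⟩ := e <;> rfl

theorem orbitTransition_label (z : List Bool) (f h : Γ → List Bool → List Bool)
    (e : Bool × Bool × Γ × List Bool) : (orbitTransition Γ z f h e).label = some e.2.2.1 := by
  obtain ⟨_ | _, -⟩ := e <;> rfl

/-- The indices of the transitions of the automaton. -/
def orbitIndex (Γ : Set thompsonV) (K : ℕ) : Set (Bool × Bool × Γ × List Bool) :=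
  {e | e.2.2.2.length ≤ K ∧ (e.1 = true ↔ e.2.2.2.length = K)}

/-- A short rule pops the bottom marker after fewer than `K` letters, a long rule pops exactly `K`
letters, so the stack decides which one applies. -/
theorem orbitTransition_unique {z : List Bool} {K : ℕ} {f h : Γ → List Bool → List Bool}
    {e e' : Bool × Bool × Γ × List Bool} (he : e ∈ orbitIndex Γ K) (he' : e' ∈ orbitIndex Γ K)
    (hq : e.2.1 = e'.2.1) (ha : e.2.2.1 = e'.2.2.1) {t t' : List (Option Bool)}
    (ht : (orbitTransition Γ z f h e).pop ++ t = (orbitTransition Γ z f h e').pop ++ t') :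
    e = e' := by
  obtain ⟨k, b, a, c⟩ := e
  obtain ⟨k', b', a', c'⟩ := e'
  obtain ⟨hle, hk⟩ := he
  obtain ⟨hle', hk'⟩ := he'
  simp only at hq ha hle hk hle' hk'
  subst hq ha
  cases k <;> cases k' <;> simp only [orbitTransition, List.append_assoc,
    List.singleton_append, reduceCtorEq, false_iff, true_iff] at ht hk hk'
  · rw [(map_some_append_none_eq ht).1]
  · obtain ⟨r, rfl, -⟩ := map_some_append_eq ht.symm
    simp at hle hk hk'
    omega
  · obtain ⟨r, rfl, -⟩ := map_some_append_eq ht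
    simp at hle' hk hk'
    omega
  · rw [List.map_injective_iff.2 (Option.some_injective _)
      (List.append_inj ht (by simp [hk, hk'])).1]

/-- The automaton with the transitions `orbitTransition` and the initial point `u 0^ω`. -/
noncomputable def orbitPDA (hΓ : Γ.Finite) (z u : List Bool) {K : ℕ} (hK : 0 < K)
    (f h : Γ → List Bool → List Bool) : PDA Γ where
  Q := Bool
  S := Option Bool
  finiteQ := inferInstance
  finiteS := inferInstance
  transitions := orbitTransition Γ z f h '' orbitIndex Γ K
  finite_transitions := by
    have := hΓ.to_subtype
    refine Set.Finite.image _ (Set.Finite.subset (s := Set.univ ×ˢ Set.univ ×ˢ Set.univ ×ˢ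
      {c : List Bool | c.length ≤ K}) ?_ fun e he => by simpa using he.1)
    exact Set.finite_univ.prod (Set.finite_univ.prod (Set.finite_univ.prod
      (List.finite_length_le Bool K)))
  pop_ne_nil := by
    rintro _ ⟨⟨k, b, a, c⟩, ⟨-, hk⟩, rfl⟩
    cases k with
    | true =>
      have hc : c.length = K := hk.1 rfl
      have : c ≠ [] := by rintro rfl; simp at hc; omega
      simpa [orbitTransition] using this
    | false => simp [orbitTransition]
  start := false
  initStack := u.map some ++ [none]
  initStack_ne_nil := by simp
  accept := {true}

theorem orbitPDA_isDeterministic (hΓ : Γ.Finite) (z u : List Bool) {K : ℕ} (hK : 0 < K)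
    (f h : Γ → List Bool → List Bool) : (orbitPDA hΓ z u hK f h).IsDeterministic := by
  rintro q s next _ _ ⟨⟨e, he, rfl⟩, hq, ⟨t, ht⟩, hn⟩ ⟨⟨e', he', rfl⟩, hq', ⟨t', ht'⟩, hn'⟩
  have hq1 := (orbitTransition_src z f h e).symm.trans
    (hq.trans (hq'.symm.trans (orbitTransition_src z f h e')))
  rw [orbitTransition_label] at hn hn'
  simp only [reduceCtorEq, false_or] at hn hn'
  exact congrArg _ (orbitTransition_unique he he' hq1 (Option.some.inj (hn.trans hn'.symm))
    (ht.trans ht'.symm))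

/-! ### Correctness of the automaton -/

/-- A configuration of the automaton that represents the image of `z 0^ω` under `w`. -/
def IsOrbitConfiguration (z : List Bool) (w : List Γ) (q : Bool) (s : List (Option Bool)) :
    Prop :=
  ∃ u, NoTrailingZero u ∧ s = u.map some ++ [none] ∧
    ((wordValue w.reverse : thompsonV) : Equiv.Perm Cantor) (z ++ₛ zeros) = u ++ₛ zeros ∧
    (q = true ↔ u ++ₛ zeros ≠ z ++ₛ zeros)

theorem wordValue_reverse_concat_apply (w : List Γ) (a : Γ) (x : Cantor) :
    ((wordValue (w ++ [a]).reverse : thompsonV) : Equiv.Perm Cantor) x =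
      ((a : thompsonV) : Equiv.Perm Cantor)
        (((wordValue w.reverse : thompsonV) : Equiv.Perm Cantor) x) := by
  simp [wordValue]

theorem exists_orbitTransition (z : List Bool) {K : ℕ} (f h : Γ → List Bool → List Bool)
    (b : Bool) (a : Γ) (v : List Bool) : ∃ e ∈ orbitIndex Γ K, e.2.1 = b ∧ e.2.2.1 = a ∧
      ∃ t, (orbitTransition Γ z f h e).pop ++ t = v.map some ++ [none] := by
  rcases lt_or_ge v.length K with hlt | hge
  · exact ⟨(false, b, a, v), ⟨hlt.le, by simpa using hlt.ne⟩, rfl, rfl, [], List.append_nil _⟩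
  · refine ⟨(true, b, a, v.take K), ⟨by simp, by simpa using hge⟩, rfl, rfl,
      (v.drop K).map some ++ [none], ?_⟩
    rw [orbitTransition, ← List.append_assoc, ← List.map_append, List.take_append_drop]

section

variable (hΓ : Γ.Finite) {z u : List Bool} {K : ℕ} (hK : 0 < K) {f h : Γ → List Bool → List Bool}
  (hu : NoTrailingZero u) (huz : u ++ₛ zeros = z ++ₛ zeros)
  (hf : ∀ (a : Γ) (c : List Bool), c.length = K → Maps (a : thompsonV) c (f a c) ∧
      z.length < (f a c).length ∧ ∀ r, NoTrailingZero (c ++ r) → NoTrailingZero (f a c ++ r))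
  (hh : ∀ (a : Γ) (c : List Bool), NoTrailingZero (h a c) ∧
    ((a : thompsonV) : Equiv.Perm Cantor) (c ++ₛ zeros) = h a c ++ₛ zeros)

include hf hh in
theorem IsOrbitConfiguration.step {e : Bool × Bool × Γ × List Bool} (he : e ∈ orbitIndex Γ K)
    {w : List Γ} {q : Bool} {t : List (Option Bool)}
    (hc : IsOrbitConfiguration z w q ((orbitTransition Γ z f h e).pop ++ t)) :
    IsOrbitConfiguration z (w ++ (orbitTransition Γ z f h e).label.toList)
      (orbitTransition Γ z f h e).dst ((orbitTransition Γ z f h e).push ++ t) := by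
  obtain ⟨k, b, a, c⟩ := e
  obtain ⟨-, hk⟩ := he
  obtain ⟨v, hv, hs, hval, -⟩ := hc
  cases k with
  | true =>
    obtain ⟨hm, hlen, hnt⟩ := hf a c (hk.1 rfl)
    obtain ⟨r, rfl, rfl⟩ := map_some_append_eq hs
    refine ⟨f a c ++ r, hnt r hv, by simp [orbitTransition], ?_, ?_⟩
    · refine (wordValue_reverse_concat_apply w a _).trans ?_
      rw [hval, hm.append r]
    -- The new stack word has no trailing 0 and is longer than `z`, so it represents another point
    -- than `z 0^ω`.
    · refine iff_of_true rfl fun e => ?_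
      have := (hnt r hv).length_le e
      simp at this
      omega
  | false =>
    rw [orbitTransition, List.append_assoc] at hs
    obtain ⟨rfl, rfl⟩ := map_some_append_none_eq hs
    refine ⟨h a v, (hh a v).1, by simp [orbitTransition], ?_, by simp [orbitTransition]⟩
    refine (wordValue_reverse_concat_apply w a _).trans ?_
    rw [hval, (hh a v).2]

include hu huz hf hh

theorem isOrbitConfiguration_of_reaches {w : List Γ} {q : (orbitPDA hΓ z u hK f h).Q}
    {s : List (orbitPDA hΓ z u hK f h).S} (hr : (orbitPDA hΓ z u hK f h).Reaches w q s) :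
    IsOrbitConfiguration z w q s := by
  induction hr with
  | init => exact ⟨u, hu, rfl, huz.symm, by simp [orbitPDA, huz]⟩
  | step hτ _ ih =>
    obtain ⟨e, he, rfl⟩ := hτ
    exact ih.step hf hh he

/-- The automaton never blocks: its stack always holds a word above one bottom marker, and some rule
fits any such stack and any letter. -/
theorem exists_reaches (w : List Γ) : ∃ q s, (orbitPDA hΓ z u hK f h).Reaches w q s := by
  induction w using List.reverseRecOn with
  | nil => exact ⟨_, _, .init⟩
  | append_singleton w a ih =>
    obtain ⟨q, s, hr⟩ := ih
    obtain ⟨v, -, rfl, -, -⟩ := isOrbitConfiguration_of_reaches hΓ hK hu huz hf hh hr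
    obtain ⟨e, he, rfl, rfl, t, ht⟩ := exists_orbitTransition (K := K) z f h q a v
    rw [← orbitTransition_src z f h e] at hr
    have := PDA.Reaches.step (M := orbitPDA hΓ z u hK f h) (t := t) ⟨e, he, rfl⟩ (ht.symm ▸ hr)
    rw [orbitTransition_label] at this
    exact ⟨_, _, this⟩

theorem orbitPDA_language :
    (orbitPDA hΓ z u hK f h).language = (movingLanguage Γ z).reverse := by
  have hmem : ∀ {w q s}, IsOrbitConfiguration z w q s →
      (q = true ↔ w ∈ (movingLanguage Γ z).reverse) := by
    rintro w q s ⟨v, -, -, hval, hq⟩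
    rw [hq, ← hval]
    rfl
  ext w
  constructor
  · rintro ⟨q, hq, s, hr⟩
    exact (hmem (isOrbitConfiguration_of_reaches hΓ hK hu huz hf hh hr)).1 hq
  · intro hw
    obtain ⟨q, s, hr⟩ := exists_reaches hΓ hK hu huz hf hh w
    exact ⟨q, (hmem (isOrbitConfiguration_of_reaches hΓ hK hu huz hf hh hr)).2 hw, s, hr⟩

end

theorem reverse_movingLanguage_mem_DCF (hΓ : Γ.Finite) (z : List Bool) :
    (movingLanguage Γ z).reverse ∈ DCF Γ := by
  obtain ⟨K, hK, hf⟩ := exists_maps_of_long hΓ z.length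
  obtain ⟨u, hu, huz⟩ := exists_noTrailingZero z
  choose! f hf using hf
  choose h hh using fun (a : Γ) => exists_image_append_zeros a
  exact ⟨orbitPDA hΓ z u hK f h, orbitPDA_isDeterministic hΓ z u hK f h,
    (orbitPDA_language hΓ hK hu huz hf hh).symm⟩


/-! ### The language classes of the co-word-problem -/

theorem movingLanguage_mem_revClass_DCF (hΓ : Γ.Finite) (z : List Bool) :
    movingLanguage Γ z ∈ revClass (DCF Γ) :=
  ⟨_, reverse_movingLanguage_mem_DCF hΓ z, (Language.reverse_involutive _).symm⟩

theorem coWordProblem_mem_cycClass_unionClass (m : ℕ)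
    (hm : ∀ a ∈ Γ, ∀ z ∈ domC a, z.length ≤ m) {C : Set (Language Γ)}
    (hC : ∀ z, movingLanguage Γ z ∈ C) :
    coWordProblem Γ ∈ cycClass (unionClass (2 ^ m) C) := by
  -- The union is indexed by the words of length `m`.
  let e : (Fin m → Bool) ≃ Fin (2 ^ m) := Fintype.equivFinOfCardEq (by simp)
  refine ⟨⨆ i, movingLanguage Γ (List.ofFn (e.symm i)), ⟨_, le_rfl, _, fun _ => hC _, rfl⟩,
    coWordProblem_eq_cyc m hm fun w => ?_⟩
  rw [Language.mem_iSup]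
  constructor
  · rintro ⟨i, hi⟩
    exact ⟨_, List.length_ofFn, hi⟩
  · rintro ⟨z, rfl, hz⟩
    refine ⟨e z.get, ?_⟩
    rwa [Equiv.symm_apply_apply, List.ofFn_get]

theorem length_le_maxlenSet (hΓ : Γ.Finite) {a : thompsonV} (ha : a ∈ Γ) {z : List Bool}
    (hz : z ∈ domC a) : z.length ≤ maxlenSet Γ :=
  ((maxlen_isGreatest a).2 ⟨z, .inl hz, rfl⟩).trans
    (le_csSup (hΓ.image _).bddAbove ⟨a, ha, rfl⟩)

theorem wordValue_reverse_of_higmanGenerators (w : List higmanGenerators) :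
    wordValue w.reverse = (wordValue w)⁻¹ := by
  induction w with
  | nil => simp [wordValue]
  | cons a w ih =>
    rw [List.reverse_cons, wordValue_append, ih]
    simp [wordValue, inv_eq_of_mem_higmanGenerators a.2]

theorem reverse_movingLanguage_higmanGenerators (z : List Bool) :
    (movingLanguage higmanGenerators z).reverse = movingLanguage higmanGenerators z := by
  ext w
  refine not_congr ?_
  rw [wordValue_reverse_of_higmanGenerators, Subgroup.coe_inv, Equiv.Perm.inv_eq_iff_eq, eq_comm]

end ThompsonCoWP

open ThompsonCoWP
theorem mainTheorem1 :
    (higmanGenerators.Finite ∧ IsMonoidGeneratingSet higmanGenerators ∧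
      coWordProblem higmanGenerators =
        cyc (movingLanguage higmanGenerators [false, false] ⊔
          movingLanguage higmanGenerators [false, true] ⊔
          movingLanguage higmanGenerators [true, false] ⊔
          movingLanguage higmanGenerators [true, true]) ∧
      coWordProblem higmanGenerators ∈
        cycClass (unionClass 4 (revClass (DCF higmanGenerators))) ∧
      coWordProblem higmanGenerators ∈ cycClass (unionClass 4 (DCF higmanGenerators))) ∧
    ∀ Γ : Set thompsonV, Γ.Finite → IsMonoidGeneratingSet Γ →
      coWordProblem Γ ∈
        cycClass (unionClass (2 ^ maxlenSet Γ) (revClass (DCF Γ))) := by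
  have hlen : ∀ a ∈ higmanGenerators, ∀ z ∈ domC a, z.length ≤ 2 := fun a ha z hz =>
    length_le_two_of_mem_higmanGenerators ha hz
  refine ⟨⟨higmanGenerators_finite, isMonoidGeneratingSet_higmanGenerators, ?_,
    coWordProblem_mem_cycClass_unionClass 2 hlen
      (movingLanguage_mem_revClass_DCF higmanGenerators_finite),
    coWordProblem_mem_cycClass_unionClass 2 hlen fun z => ?_⟩,
    fun Γ hΓ _ => coWordProblem_mem_cycClass_unionClass _
      (fun a ha z hz => length_le_maxlenSet hΓ ha hz) (movingLanguage_mem_revClass_DCF hΓ)⟩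
  · refine coWordProblem_eq_cyc 2 hlen fun w => ?_
    constructor
    · rintro (((h | h) | h) | h) <;> exact ⟨_, rfl, h⟩
    · rintro ⟨z, hz, h⟩
      obtain ⟨a, b, rfl⟩ := List.length_eq_two.1 hz
      cases a <;> cases b
      · exact .inl (.inl (.inl h))
      · exact .inl (.inl (.inr h))
      · exact .inl (.inr h)
      · exact .inr h
  -- A permutation and its inverse move the same points, so `L_z` is closed under reversal and is
  -- itself deterministic context-free.
  · exact reverse_movingLanguage_higmanGenerators z ▸
      reverse_movingLanguage_mem_DCF higmanGenerators_finite z
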